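/- Let $\Bbbk$ be a field of characteristic zero and let $\Omega$ be a set. An $\Omega$-algebra is a $\Bbbk$-linear space with bilinear operations $\circ_\omega$, $\omega\in\Omega$; the variety $\mathrm{Var}(B)$ generated by an $\Omega$-algebra $B$ is the class of all $\Omega$-algebras satisfying every polynomial identity of $B$ (nonassociative polynomials over $\Bbbk$ in the operations $\circ_\omega$). Let $A$ be a $\Bbbk$-linear space with bilinear operations $\vdash_\omega,\dashv_\omega$, $\omega\in\Omega$, belonging to the variety $\mathrm{di}$-$\mathrm{Alg}_0$, that is, satisfying \[ (x\vdash_\omega y-x\dashv_\omega y)\vdash_\mu z=0,\qquad x\dashv_\mu(y\vdash_\omega z-y\dashv_\omega z)=0\qquad(\omega,\mu\in\Omega). \] Let $\bar A=A/\mathrm{span}\{a\vdash_\omega b-a\dashv_\omega b\mid a,b\in A,\ \omega\in\Omega\}$, with the operations $\bar a\circ_\omega\bar b=\overline{a\vdash_\omega b}=\overline{a\dashv_\omega b}$, and let $\hat A=\bar A\ltimes A$ be the $\Omega$-algebra on the space $\bar A\oplus A$ that contains $\bar A$ as a subalgebra and in which \[ \bar a\circ_\omega b=a\vdash_\omega b,\qquad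 a\circ_\omega\bar b=a\dashv_\omega b,\qquad a\circ_\omega b=0\qquad(a,b\in A). \] Let $m\ge 1$ and let $Z=\mathrm{pre}\text{-}\mathrm{Com}\langle z_1,\dots,z_m\rangle$ be the free pre-commutative (Zinbiel) algebra on $m$ generators, i.e. the free algebra with one bilinear product satisfying $(xy+yx)z=x(yz)$. Let $Z\boxtimes A$ be the space $Z\otimes A$ with the operations \[ (z\otimes a)\circ_\omega(w\otimes b)=zw\otimes(a\vdash_\omega b)+wz\otimes(a\dashv_\omega b)\qquad(z,w\in Z,\ a,b\in A). \] Then \[ \mathrm{Var}(Z\boxtimes A)=\mathrm{Var}(\hat A). \] -/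

import Mathlib

open scoped TensorProduct

universe u v w t

noncomputable section

/-- A (not necessarily associative) algebra over `k` with a family of bilinear operations
`∘_ω`, `ω ∈ Ω`. -/
structure OmegaAlgebra (k : Type u) [Field k] (Ω : Type v) : Type (max u v (w + 1)) where
  carrier : Type w
  [addCommGroup : AddCommGroup carrier]
  [module : Module k carrier]
  op : Ω → carrier →ₗ[k] carrier →ₗ[k] carrier

attribute [instance] OmegaAlgebra.addCommGroup OmegaAlgebra.module

/-- A linear space over `k` with a doubled family of bilinear operations:
`left ω a b` is `a ⊢_ω b` and `right ω a b` is `a ⊣_ω b`. -/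
structure OmegaDialgebra (k : Type u) [Field k] (Ω : Type v) : Type (max u v (w + 1)) where
  carrier : Type w
  [addCommGroup : AddCommGroup carrier]
  [module : Module k carrier]
  left : Ω → carrier →ₗ[k] carrier →ₗ[k] carrier
  right : Ω → carrier →ₗ[k] carrier →ₗ[k] carrier

attribute [instance] OmegaDialgebra.addCommGroup OmegaDialgebra.module

/-! ### Identities and varieties -/

/-- Nonassociative monomials in variables `X` with operation symbols `Ω`. -/
inductive OmegaMonomial (Ω : Type v) (X : Type w) : Type (max v w)
  | var (x : X) : OmegaMonomial Ω X
  | op (ω : Ω) (s t : OmegaMonomial Ω X) : OmegaMonomial Ω X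

/-- Elements of the free `Ω`-algebra on `x₀, x₁, …`: nonassociative polynomials, i.e. linear
combinations of nonassociative monomials. -/
abbrev OmegaPolynomial (k : Type u) [Field k] (Ω : Type v) : Type (max u v) :=
  OmegaMonomial Ω ℕ →₀ k

namespace OmegaAlgebra

variable {k : Type u} [Field k] {Ω : Type v}

/-- Value of a monomial in `B` under a substitution of the variables. -/
def evalMonomial (B : OmegaAlgebra.{u, v, w} k Ω) (x : ℕ → B.carrier) :
    OmegaMonomial Ω ℕ → B.carrier
  | .var i => x i
  | .op ω s t => B.op ω (B.evalMonomial x s) (B.evalMonomial x t)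

/-- Value of a polynomial in `B` under a substitution of the variables. -/
def eval (B : OmegaAlgebra.{u, v, w} k Ω) (x : ℕ → B.carrier) :
    OmegaPolynomial k Ω →ₗ[k] B.carrier :=
  Finsupp.linearCombination k (B.evalMonomial x)

/-- `f = 0` is an identity on `B`. -/
def Satisfies (B : OmegaAlgebra.{u, v, w} k Ω) (f : OmegaPolynomial k Ω) : Prop :=
  ∀ x : ℕ → B.carrier, B.eval x f = 0

/-- The variety generated by `B`: the class of all `Ω`-algebras (in an arbitrary universe) on
which every identity of `B` holds. -/
def Var (B : OmegaAlgebra.{u, v, w} k Ω) : Set (OmegaAlgebra.{u, v, t} k Ω) :=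
  {C | ∀ f : OmegaPolynomial k Ω, B.Satisfies f → C.Satisfies f}

/-- The split null extension `A ⋉ M`: the space `A ⊕ M` where `A` is a subalgebra, `A` acts on `M`
by `a ∘_ω u = l ω a u` and `u ∘_ω a = r ω u a`, and `M ∘_ω M = 0`. -/
def splitNullExtension (A : OmegaAlgebra.{u, v, w} k Ω)
    (M : Type t) [AddCommGroup M] [Module k M]
    (l : Ω → A.carrier →ₗ[k] M →ₗ[k] M) (r : Ω → M →ₗ[k] A.carrier →ₗ[k] M) :
    OmegaAlgebra.{u, v, max w t} k Ω where
  carrier := A.carrier × M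
  op ω :=
    ((A.op ω).compl₁₂ (LinearMap.fst k A.carrier M) (LinearMap.fst k A.carrier M)).compr₂
        (LinearMap.inl k A.carrier M)
      + ((l ω).compl₁₂ (LinearMap.fst k A.carrier M) (LinearMap.snd k A.carrier M)).compr₂
        (LinearMap.inr k A.carrier M)
      + ((r ω).compl₁₂ (LinearMap.snd k A.carrier M) (LinearMap.fst k A.carrier M)).compr₂
        (LinearMap.inr k A.carrier M)

end OmegaAlgebra

/-- A bilinear operation on `M` for which `I` is a two-sided ideal induces one on `M ⧸ I`. -/
def quotientOp {k : Type u} [Field k] {M : Type w} [AddCommGroup M] [Module k M]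
    (I : Submodule k M) (B : M →ₗ[k] M →ₗ[k] M)
    (h₁ : ∀ x ∈ I, ∀ y, B x y ∈ I) (h₂ : ∀ x, ∀ y ∈ I, B x y ∈ I) :
    (M ⧸ I) →ₗ[k] (M ⧸ I) →ₗ[k] (M ⧸ I) :=
  (I.liftQ (I.liftQ (B.compr₂ I.mkQ) (fun x hx => by
      rw [LinearMap.mem_ker]
      ext y
      simpa using h₁ x hx y)).flip (fun y hy => by
    rw [LinearMap.mem_ker]
    ext x
    simpa using h₂ x y hy)).flip

/-! ### Dialgebras of the variety di-Alg₀ and the algebra `Â` -/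

namespace OmegaDialgebra

variable {k : Type u} [Field k] {Ω : Type v}

/-- Membership in the variety di-Alg₀:
`(x ⊢_ω y - x ⊣_ω y) ⊢_μ z = 0` and `x ⊣_μ (y ⊢_ω z - y ⊣_ω z) = 0`. -/
structure IsDiAlg₀ (D : OmegaDialgebra.{u, v, w} k Ω) : Prop where
  left_identity : ∀ (ω μ : Ω) (x y z : D.carrier),
    D.left μ (D.left ω x y - D.right ω x y) z = 0
  right_identity : ∀ (ω μ : Ω) (x y z : D.carrier),
    D.right μ x (D.left ω y z - D.right ω y z) = 0

/-- The span of all `a ⊢_ω b - a ⊣_ω b`. -/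
def differenceSpan (D : OmegaDialgebra.{u, v, w} k Ω) : Submodule k D.carrier :=
  Submodule.span k {d | ∃ (ω : Ω) (a b : D.carrier), d = D.left ω a b - D.right ω a b}

variable {D : OmegaDialgebra.{u, v, w} k Ω}

theorem IsDiAlg₀.left_eq_zero (hD : D.IsDiAlg₀) (μ : Ω) {d : D.carrier}
    (hd : d ∈ D.differenceSpan) : D.left μ d = 0 := by
  have h : D.differenceSpan ≤ LinearMap.ker (D.left μ) := by
    refine Submodule.span_le.2 ?_
    rintro _ ⟨ω, a, b, rfl⟩
    exact LinearMap.mem_ker.2 (LinearMap.ext fun z => hD.left_identity ω μ a b z)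
  exact h hd

theorem IsDiAlg₀.right_eq_zero (hD : D.IsDiAlg₀) (μ : Ω) {d : D.carrier}
    (hd : d ∈ D.differenceSpan) : (D.right μ).flip d = 0 := by
  have h : D.differenceSpan ≤ LinearMap.ker (D.right μ).flip := by
    refine Submodule.span_le.2 ?_
    rintro _ ⟨ω, a, b, rfl⟩
    exact LinearMap.mem_ker.2 (LinearMap.ext fun z => hD.right_identity ω μ z a b)
  exact h hd

theorem IsDiAlg₀.left_mem (hD : D.IsDiAlg₀) (μ : Ω) (x : D.carrier) {d : D.carrier}
    (hd : d ∈ D.differenceSpan) : D.left μ x d ∈ D.differenceSpan := by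
  have h : D.left μ x d - D.right μ x d ∈ D.differenceSpan :=
    Submodule.subset_span ⟨μ, x, d, rfl⟩
  have h0 : D.right μ x d = 0 := LinearMap.congr_fun (hD.right_eq_zero μ hd) x
  rwa [h0, sub_zero] at h

/-- The algebra `D̄ = D / span (a ⊢_ω b - a ⊣_ω b)`, on which `⊢_ω` and `⊣_ω` induce one and the
same operation `∘_ω`. -/
def bar (D : OmegaDialgebra.{u, v, w} k Ω) (hD : D.IsDiAlg₀) : OmegaAlgebra.{u, v, w} k Ω where
  carrier := D.carrier ⧸ D.differenceSpan
  op ω := quotientOp D.differenceSpan (D.left ω)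
    (fun x hx y => by rw [hD.left_eq_zero ω hx]; exact Submodule.zero_mem _)
    (fun x _ hy => hD.left_mem ω x hy)

/-- The left action `ā ∘_ω b = a ⊢_ω b` of `D̄` on `D`. -/
def barLeft (D : OmegaDialgebra.{u, v, w} k Ω) (hD : D.IsDiAlg₀) (ω : Ω) :
    (D.bar hD).carrier →ₗ[k] D.carrier →ₗ[k] D.carrier :=
  D.differenceSpan.liftQ (D.left ω) (fun _ hd => LinearMap.mem_ker.2 (hD.left_eq_zero ω hd))

/-- The right action `a ∘_ω b̄ = a ⊣_ω b` of `D̄` on `D`. -/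
def barRight (D : OmegaDialgebra.{u, v, w} k Ω) (hD : D.IsDiAlg₀) (ω : Ω) :
    D.carrier →ₗ[k] (D.bar hD).carrier →ₗ[k] D.carrier :=
  LinearMap.flip (D.differenceSpan.liftQ (D.right ω).flip
    (fun _ hd => LinearMap.mem_ker.2 (hD.right_eq_zero ω hd)))

/-- The algebra `D̂ = D̄ ⋉ D`. -/
def hat (D : OmegaDialgebra.{u, v, w} k Ω) (hD : D.IsDiAlg₀) : OmegaAlgebra.{u, v, w} k Ω :=
  (D.bar hD).splitNullExtension D.carrier (D.barLeft hD) (D.barRight hD)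

end OmegaDialgebra

/-! ### Free pre-commutative (Zinbiel) algebras -/

/-- The smallest two-sided ideal of the free nonassociative algebra on `X` that contains all
`(xy + yx)z - x(yz)`. -/
def zinbielIdeal (k : Type u) [Field k] (X : Type w) :
    Submodule k (FreeNonUnitalNonAssocAlgebra k X) :=
  sInf {I | (∀ x y z : FreeNonUnitalNonAssocAlgebra k X, (x * y + y * x) * z - x * (y * z) ∈ I) ∧
    (∀ x ∈ I, ∀ y, x * y ∈ I) ∧ (∀ x, ∀ y ∈ I, x * y ∈ I)}

/-- The free pre-commutative algebra on `X`, i.e. the free algebra with one bilinear product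
satisfying `(xy + yx)z = x(yz)`. -/
abbrev FreeZinbiel (k : Type u) [Field k] (X : Type w) : Type (max u w) :=
  FreeNonUnitalNonAssocAlgebra k X ⧸ zinbielIdeal k X

/-- The product of the free pre-commutative algebra. -/
def FreeZinbiel.product (k : Type u) [Field k] (X : Type w) :
    FreeZinbiel k X →ₗ[k] FreeZinbiel k X →ₗ[k] FreeZinbiel k X :=
  quotientOp (zinbielIdeal k X) (LinearMap.mul k (FreeNonUnitalNonAssocAlgebra k X))
    (fun x hx y => (Submodule.mem_sInf).2 fun I hI =>
      hI.2.1 x ((Submodule.mem_sInf).1 hx I hI) y)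
    (fun x y hy => (Submodule.mem_sInf).2 fun I hI =>
      hI.2.2 x y ((Submodule.mem_sInf).1 hy I hI))

/-- For a linear space `Z` with a bilinear product, the space `Z ⊗ D` with the operations
`(z ⊗ a) ∘_ω (w ⊗ b) = zw ⊗ (a ⊢_ω b) + wz ⊗ (a ⊣_ω b)`. -/
def boxTimes {k : Type u} [Field k] {Ω : Type v} {Z : Type t} [AddCommGroup Z] [Module k Z]
    (product : Z →ₗ[k] Z →ₗ[k] Z) (D : OmegaDialgebra.{u, v, w} k Ω) :
    OmegaAlgebra.{u, v, max w t} k Ω where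
  carrier := Z ⊗[k] D.carrier
  op ω := TensorProduct.map₂ product (D.left ω) + TensorProduct.map₂ product.flip (D.right ω)

end

/-!
Model a Zinbiel product on functions with `f ⋆ g = (∫ f) g`, and let `α`, `β` be linear maps into a
commutative algebra `R` that behave like `f ↦ ∫ f` and `f ↦ f`. Then `z ⊗ a ↦ α z ⊗ ā + β z ⊗ a` is
a homomorphism `Z ⊠ A → R ⊗ Â`, and over an infinite field `R ⊗ Â` has the identities of `Â`, since
coefficients in `R` are specializations of the variables of a polynomial ring.

The left multiplications of a Zinbiel algebra commute. They generate a commutative algebra `S`, and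
in `R = S ⊕ Z` with `Z² = 0` one may take for `α` the left multiplication and for `β` the inclusion
of `Z`; the homomorphism is then injective, so identities of `Â` hold on `Z ⊠ A`. Conversely, a
nonzero free Zinbiel algebra maps to `k[X]` with the product `f ⋆ g = (∫ f) g`. Taking `α f = ∫₀¹ f`
and `β f = f(1)` gives a homomorphism `Z ⊠ A → k ⊗ Â = Â`, which is surjective because `(α, β)` maps
onto `k²`, so identities of `Z ⊠ A` hold on `Â`.
-/

noncomputable section

open Polynomial

universe s s'

namespace OmegaAlgebra

variable {k : Type u} [Field k] {Ω : Type v}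

/-- Homomorphisms of `Ω`-algebras, as a property of linear maps. -/
def IsHom (B : OmegaAlgebra.{u, v, w} k Ω) (C : OmegaAlgebra.{u, v, s} k Ω)
    (φ : B.carrier →ₗ[k] C.carrier) : Prop :=
  ∀ ω x y, φ (B.op ω x y) = C.op ω (φ x) (φ y)

section IsHom

variable {B : OmegaAlgebra.{u, v, w} k Ω} {C : OmegaAlgebra.{u, v, s} k Ω}
  {φ : B.carrier →ₗ[k] C.carrier}

theorem IsHom.map_evalMonomial (hφ : B.IsHom C φ) (x : ℕ → B.carrier) (s : OmegaMonomial Ω ℕ) :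
    φ (B.evalMonomial x s) = C.evalMonomial (φ ∘ x) s := by
  induction s with
  | var i => rfl
  | op ω s t hs ht => simp only [evalMonomial, hφ ω, hs, ht]

theorem IsHom.map_eval (hφ : B.IsHom C φ) (x : ℕ → B.carrier) (f : OmegaPolynomial k Ω) :
    φ (B.eval x f) = C.eval (φ ∘ x) f := by
  simp only [eval, Finsupp.linearCombination_apply, map_finsuppSum, map_smul,
    hφ.map_evalMonomial]

theorem IsHom.satisfies_of_injective (hφ : B.IsHom C φ) (hinj : Function.Injective φ)
    {f : OmegaPolynomial k Ω} (hf : C.Satisfies f) : B.Satisfies f := fun x =>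
  hinj (by rw [hφ.map_eval, hf, map_zero])

theorem IsHom.satisfies_of_surjective (hφ : B.IsHom C φ) (hsurj : Function.Surjective φ)
    {f : OmegaPolynomial k Ω} (hf : B.Satisfies f) : C.Satisfies f := fun x => by
  obtain ⟨y, rfl⟩ := hsurj.comp_left x
  rw [← hφ.map_eval, hf, map_zero]

end IsHom

theorem var_eq_of_satisfies_iff {B : OmegaAlgebra.{u, v, w} k Ω} {C : OmegaAlgebra.{u, v, s} k Ω}
    (h : ∀ f, B.Satisfies f ↔ C.Satisfies f) : (B.Var : Set (OmegaAlgebra.{u, v, t} k Ω)) = C.Var :=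
  Set.ext fun _ => forall_congr' fun f => imp_congr_left (h f)

end OmegaAlgebra

section TensorProduct

variable {k : Type*} [CommRing k]

theorem bilinear_ext_tmul {M N M' N' P : Type*} [AddCommGroup M] [Module k M] [AddCommGroup N]
    [Module k N] [AddCommGroup M'] [Module k M'] [AddCommGroup N'] [Module k N'] [AddCommGroup P]
    [Module k P] {F G : M ⊗[k] N →ₗ[k] M' ⊗[k] N' →ₗ[k] P}
    (h : ∀ m n m' n', F (m ⊗ₜ n) (m' ⊗ₜ n') = G (m ⊗ₜ n) (m' ⊗ₜ n')) : F = G := by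
  ext m n m' n'
  exact h m n m' n'

theorem eq_zero_of_forall_rTensor_aeval_eq_zero [IsDomain k] [Infinite k] {σ M : Type*}
    [AddCommGroup M] [Module k M] [Module.Free k M] {u : MvPolynomial σ k ⊗[k] M}
    (hu : ∀ c : σ → k, (MvPolynomial.aeval (R := k) c).toLinearMap.rTensor M u = 0) : u = 0 := by
  classical
  let b := Module.Free.chooseBasis k M
  apply (TensorProduct.equivFinsuppOfBasisRight b).injective
  ext1 i
  rw [map_zero, Finsupp.zero_apply, TensorProduct.equivFinsuppOfBasisRight_apply]
  refine MvPolynomial.funext fun c => ?_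
  have eval_coord : (MvPolynomial.aeval (R := k) c).toLinearMap ∘ₗ
        (TensorProduct.rid k (MvPolynomial σ k)).toLinearMap ∘ₗ (b.coord i).lTensor _ =
      (TensorProduct.rid k k).toLinearMap ∘ₗ (b.coord i).lTensor k ∘ₗ
        (MvPolynomial.aeval (R := k) c).toLinearMap.rTensor M := by
    refine TensorProduct.ext' fun p m => ?_
    simp [MvPolynomial.smul_eval, MvPolynomial.aeval_eq_eval]
  rw [map_zero, ← MvPolynomial.aeval_eq_eval, ← AlgHom.coe_toLinearMap]
  simpa only [LinearMap.comp_apply, LinearEquiv.coe_coe, hu, map_zero] using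
    LinearMap.congr_fun eval_coord u

end TensorProduct

namespace OmegaAlgebra

variable {k : Type u} [Field k] {Ω : Type v}

/-- The extension of scalars `R ⊗ B`, with `(r ⊗ a) ∘_ω (s ⊗ b) = rs ⊗ (a ∘_ω b)`, regarded as an
`Ω`-algebra over the original field. -/
def extendScalars (R : Type s) [CommRing R] [Algebra k R] (B : OmegaAlgebra.{u, v, w} k Ω) :
    OmegaAlgebra.{u, v, max w s} k Ω where
  carrier := R ⊗[k] B.carrier
  op ω := TensorProduct.map₂ (LinearMap.mul k R) (B.op ω)

theorem isHom_extendScalars_mk (R : Type s) [CommRing R] [Algebra k R]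
    (B : OmegaAlgebra.{u, v, w} k Ω) :
    B.IsHom (B.extendScalars R) (TensorProduct.mk k R B.carrier 1) := fun ω a b =>
  congrArg (· ⊗ₜ[k] B.op ω a b) (mul_one (1 : R)).symm

theorem isHom_extendScalars_rTensor {R : Type s} [CommRing R] [Algebra k R] {S : Type t}
    [CommRing S] [Algebra k S] (B : OmegaAlgebra.{u, v, w} k Ω) (g : R →ₐ[k] S) :
    (B.extendScalars R).IsHom (B.extendScalars S) (g.toLinearMap.rTensor B.carrier) := fun ω =>
  LinearMap.congr_fun₂ (f := ((B.extendScalars R).op ω).compr₂ (g.toLinearMap.rTensor B.carrier))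
    (g := ((B.extendScalars S).op ω).compl₁₂ (g.toLinearMap.rTensor B.carrier)
      (g.toLinearMap.rTensor B.carrier))
    (bilinear_ext_tmul fun r a r' b => congrArg (· ⊗ₜ[k] B.op ω a b) (map_mul g r r'))

theorem Satisfies.of_extendScalars {R : Type s} [CommRing R] [Nontrivial R] [Algebra k R]
    {B : OmegaAlgebra.{u, v, w} k Ω} {f : OmegaPolynomial k Ω}
    (hf : (B.extendScalars R).Satisfies f) : B.Satisfies f :=
  (B.isHom_extendScalars_mk R).satisfies_of_injective
    (Module.Flat.tensorProduct_mk_injective k B.carrier R) hf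

theorem Satisfies.extendScalars_self {B : OmegaAlgebra.{u, v, w} k Ω} {f : OmegaPolynomial k Ω}
    (hf : B.Satisfies f) : (B.extendScalars k).Satisfies f :=
  (B.isHom_extendScalars_mk k).satisfies_of_surjective
    (TensorProduct.mk_surjective k B.carrier k Function.surjective_id) hf

theorem Satisfies.extendScalars_mvPolynomial [Infinite k] {B : OmegaAlgebra.{u, v, w} k Ω}
    {f : OmegaPolynomial k Ω} (hf : B.Satisfies f) (σ : Type s) :
    (B.extendScalars (MvPolynomial σ k)).Satisfies f := fun x =>
  eq_zero_of_forall_rTensor_aeval_eq_zero fun c =>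
    ((B.isHom_extendScalars_rTensor (MvPolynomial.aeval c)).map_eval x f).trans
      (hf.extendScalars_self _)

theorem Satisfies.extendScalars [Infinite k] {B : OmegaAlgebra.{u, v, w} k Ω}
    {f : OmegaPolynomial k Ω} (hf : B.Satisfies f) (R : Type s) [CommRing R] [Algebra k R] :
    (B.extendScalars R).Satisfies f := by
  refine (B.isHom_extendScalars_rTensor (MvPolynomial.aeval (id : R → R))).satisfies_of_surjective
    (LinearMap.rTensor_surjective _ fun r => ?_) (hf.extendScalars_mvPolynomial R)
  exact ⟨MvPolynomial.X r, MvPolynomial.aeval_X _ r⟩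

theorem splitNullExtension_op_apply {A : OmegaAlgebra.{u, v, w} k Ω} {M : Type t} [AddCommGroup M]
    [Module k M] (l : Ω → A.carrier →ₗ[k] M →ₗ[k] M) (r : Ω → M →ₗ[k] A.carrier →ₗ[k] M) (ω : Ω)
    (x y : A.carrier × M) :
    (A.splitNullExtension M l r).op ω x y =
      (A.op ω x.1 y.1, l ω x.1 y.2 + r ω x.2 y.1) := by
  refine Prod.ext ?_ ?_
  · change A.op ω x.1 y.1 + 0 + 0 = _
    rw [add_zero, add_zero]
  · change 0 + l ω x.1 y.2 + r ω x.2 y.1 = _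
    rw [zero_add]

end OmegaAlgebra

namespace OmegaDialgebra

variable {k : Type u} [Field k] {Ω : Type v} (D : OmegaDialgebra.{u, v, w} k Ω) (hD : D.IsDiAlg₀)

/-- The map `a ↦ ā` into the subalgebra `D̄` of `D̂`. -/
def toHatBar : D.carrier →ₗ[k] (D.hat hD).carrier :=
  LinearMap.inl k (D.carrier ⧸ D.differenceSpan) D.carrier ∘ₗ D.differenceSpan.mkQ

/-- The inclusion of `D` as the square-zero ideal of `D̂`. -/
def toHatIdeal : D.carrier →ₗ[k] (D.hat hD).carrier :=
  LinearMap.inr k (D.carrier ⧸ D.differenceSpan) D.carrier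

/-- The projection of `D̂ = D̄ ⋉ D` onto the ideal `D`. -/
def hatSnd : (D.hat hD).carrier →ₗ[k] D.carrier :=
  LinearMap.snd k (D.carrier ⧸ D.differenceSpan) D.carrier

theorem hatSnd_comp_toHatIdeal : D.hatSnd hD ∘ₗ D.toHatIdeal hD = LinearMap.id := rfl

theorem exists_toHatBar_add_toHatIdeal (x : (D.hat hD).carrier) :
    ∃ a b, D.toHatBar hD a + D.toHatIdeal hD b = x := by
  obtain ⟨a, ha⟩ := D.differenceSpan.mkQ_surjective x.1
  exact ⟨a, x.2, Prod.ext ((add_zero _).trans ha) (zero_add x.2)⟩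

theorem toHatBar_right (ω : Ω) (a b : D.carrier) :
    D.toHatBar hD (D.right ω a b) = D.toHatBar hD (D.left ω a b) :=
  congrArg (LinearMap.inl k (D.carrier ⧸ D.differenceSpan) D.carrier)
    ((Submodule.Quotient.eq D.differenceSpan).2 (Submodule.subset_span ⟨ω, a, b, rfl⟩)).symm

theorem hat_op_toHatBar_toHatBar (ω : Ω) (a b : D.carrier) :
    (D.hat hD).op ω (D.toHatBar hD a) (D.toHatBar hD b) = D.toHatBar hD (D.left ω a b) :=
  (OmegaAlgebra.splitNullExtension_op_apply _ _ ω _ _).trans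
    (Prod.ext rfl (show D.barLeft hD ω _ 0 + D.barRight hD ω 0 _ = 0 by simp))

theorem hat_op_toHatBar_toHatIdeal (ω : Ω) (a b : D.carrier) :
    (D.hat hD).op ω (D.toHatBar hD a) (D.toHatIdeal hD b) = D.toHatIdeal hD (D.left ω a b) :=
  (OmegaAlgebra.splitNullExtension_op_apply _ _ ω _ _).trans
    (Prod.ext (map_zero ((D.bar hD).op ω _))
      (show D.left ω a b + D.barRight hD ω 0 0 = D.left ω a b by simp))

theorem hat_op_toHatIdeal_toHatBar (ω : Ω) (a b : D.carrier) :
    (D.hat hD).op ω (D.toHatIdeal hD a) (D.toHatBar hD b) = D.toHatIdeal hD (D.right ω a b) :=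
  (OmegaAlgebra.splitNullExtension_op_apply _ _ ω _ _).trans
    (Prod.ext (LinearMap.map_zero₂ ((D.bar hD).op ω) _)
      (show D.barLeft hD ω 0 0 + D.right ω a b = D.right ω a b by simp))

theorem hat_op_toHatIdeal_toHatIdeal (ω : Ω) (a b : D.carrier) :
    (D.hat hD).op ω (D.toHatIdeal hD a) (D.toHatIdeal hD b) = 0 :=
  (OmegaAlgebra.splitNullExtension_op_apply _ _ ω _ _).trans
    (Prod.ext (map_zero ((D.bar hD).op ω 0))
      (show D.barLeft hD ω 0 b + D.barRight hD ω a 0 = 0 by simp))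

end OmegaDialgebra

section Zinbiel

variable {k : Type u} [CommRing k] {Z : Type t} [AddCommGroup Z] [Module k Z]

/-- The pre-commutative (Zinbiel) identity `(xy + yx)z = x(yz)` for a bilinear product `p`. -/
def IsZinbiel (p : Z →ₗ[k] Z →ₗ[k] Z) : Prop :=
  ∀ x y z, p (p x y + p y x) z = p x (p y z)

theorem IsZinbiel.left_comm {p : Z →ₗ[k] Z →ₗ[k] Z} (hp : IsZinbiel p) (x y z : Z) :
    p x (p y z) = p y (p x z) := by
  rw [← hp, ← hp, add_comm]

/-- Linear maps `α`, `β` from a space with product `p` to a commutative algebra that behave like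
`f ↦ ∫ f` and `f ↦ f` on functions with the product `p f g = (∫ f) g`: the first condition is
integration by parts, the second one the definition of `p`. -/
structure IsIntegrationPair {R : Type*} [CommRing R] [Algebra k R] (p : Z →ₗ[k] Z →ₗ[k] Z)
    (α β : Z →ₗ[k] R) : Prop where
  mul_integral : ∀ x y, α x * α y = α (p x y + p y x)
  integral_mul : ∀ x y, α x * β y = β (p x y)

namespace IsIntegrationPair

variable {R : Type*} [CommRing R] [Algebra k R] {p : Z →ₗ[k] Z →ₗ[k] Z} {α β : Z →ₗ[k] R}

theorem isZinbiel (h : IsIntegrationPair p α β) (hβ : Function.Injective β) : IsZinbiel p :=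
  fun x y z => hβ <| by
    rw [← h.integral_mul, ← h.mul_integral, mul_assoc, h.integral_mul, h.integral_mul]

theorem comp (h : IsIntegrationPair p α β) {W : Type*} [AddCommGroup W] [Module k W]
    {q : W →ₗ[k] W →ₗ[k] W} {θ : W →ₗ[k] Z} (hθ : ∀ x y, θ (q x y) = p (θ x) (θ y)) :
    IsIntegrationPair q (α ∘ₗ θ) (β ∘ₗ θ) where
  mul_integral x y := by simp only [LinearMap.comp_apply, map_add θ, hθ, h.mul_integral]
  integral_mul x y := by simp only [LinearMap.comp_apply, hθ, h.integral_mul]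

theorem map (h : IsIntegrationPair p α β) {S : Type*} [CommRing S] [Algebra k S] (g : R →ₐ[k] S) :
    IsIntegrationPair p (g.toLinearMap ∘ₗ α) (g.toLinearMap ∘ₗ β) where
  mul_integral x y := by
    simp only [LinearMap.comp_apply, AlgHom.toLinearMap_apply, ← h.mul_integral, map_mul]
  integral_mul x y := by
    simp only [LinearMap.comp_apply, AlgHom.toLinearMap_apply, ← h.integral_mul, map_mul]

end IsIntegrationPair

theorem isIntegrationPair_trivSqZeroExt {S : Type*} [CommRing S] [Algebra k S] [Module S Z]
    [Module Sᵐᵒᵖ Z] [IsCentralScalar S Z] [IsScalarTower k S Z] [IsScalarTower k Sᵐᵒᵖ Z]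
    {p : Z →ₗ[k] Z →ₗ[k] Z} {α : Z →ₗ[k] S} (hα : ∀ x y, α x * α y = α (p x y + p y x))
    (hsmul : ∀ x y, α x • y = p x y) :
    IsIntegrationPair p ((TrivSqZeroExt.inlAlgHom k S Z).toLinearMap ∘ₗ α)
      ((TrivSqZeroExt.inrHom S Z).restrictScalars k) where
  mul_integral x y := by
    simp only [LinearMap.comp_apply, AlgHom.toLinearMap_apply, ← map_mul, hα]
  integral_mul x y := by
    simpa [hsmul] using TrivSqZeroExt.inl_mul_inr (α x) y

open scoped IsMulCommutative in
theorem IsZinbiel.exists_isIntegrationPair {p : Z →ₗ[k] Z →ₗ[k] Z} (hp : IsZinbiel p) :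
    ∃ (R : Type t) (_ : CommRing R) (_ : Algebra k R) (α β : Z →ₗ[k] R) (π : R →ₗ[k] Z),
      IsIntegrationPair p α β ∧ π ∘ₗ α = 0 ∧ π ∘ₗ β = LinearMap.id := by
  have comm : ∀ f ∈ Set.range p, ∀ g ∈ Set.range p, (f * g : Module.End k Z) = g * f := by
    rintro _ ⟨x, rfl⟩ _ ⟨y, rfl⟩
    exact LinearMap.ext (hp.left_comm x y)
  let S := Algebra.adjoin k (Set.range p : Set (Module.End k Z))
  have : IsMulCommutative S := Algebra.isMulCommutative_adjoin k comm
  let : Module Sᵐᵒᵖ Z := Module.compHom Z ((RingHom.id S).fromOpposite mul_comm)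
  have : IsCentralScalar S Z := ⟨fun _ _ => rfl⟩
  have : IsScalarTower k Sᵐᵒᵖ Z := ⟨fun _ _ _ => rfl⟩
  let α : Z →ₗ[k] S := p.codRestrict S.toSubmodule fun x => Algebra.subset_adjoin ⟨x, rfl⟩
  refine ⟨TrivSqZeroExt S Z, inferInstance, inferInstance, _, _,
    (TrivSqZeroExt.sndHom S Z).restrictScalars k,
    isIntegrationPair_trivSqZeroExt (α := α) (fun x y => Subtype.ext <| LinearMap.ext fun z =>
      (hp x y z).symm) (fun x y => rfl), rfl, rfl⟩

end Zinbiel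

namespace FreeZinbiel

variable {k : Type u} [Field k] {X : Type w}

theorem isZinbiel_product : IsZinbiel (product k X) := by
  rintro ⟨x⟩ ⟨y⟩ ⟨z⟩
  exact (Submodule.Quotient.eq _).2 (Submodule.mem_sInf.2 fun I hI => hI.1 x y z)

/-- The generator of the free pre-commutative algebra given by `i : X`. -/
def of (i : X) : FreeZinbiel k X :=
  Submodule.Quotient.mk (FreeNonUnitalNonAssocAlgebra.of k i)

theorem exists_lift {Z : Type*} [AddCommGroup Z] [Module k Z] {p : Z →ₗ[k] Z →ₗ[k] Z}
    (hp : IsZinbiel p) (g : X → Z) :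
    ∃ θ : FreeZinbiel k X →ₗ[k] Z,
      (∀ x y, θ (product k X x y) = p (θ x) (θ y)) ∧ ∀ i, θ (of i) = g i := by
  let : NonUnitalNonAssocRing Z :=
    { ‹AddCommGroup Z› with
      mul := fun x y => p x y
      left_distrib := fun x => map_add (p x)
      right_distrib := fun x y => LinearMap.map_add₂ p x y
      zero_mul := LinearMap.map_zero₂ p
      mul_zero := fun x => map_zero (p x) }
  have : IsScalarTower k Z Z := ⟨fun c x y => LinearMap.map_smul₂ p c x y⟩
  have : SMulCommClass k Z Z := ⟨fun c x y => ((p x).map_smul c y).symm⟩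
  let φ := FreeNonUnitalNonAssocAlgebra.lift k g
  have hφ : zinbielIdeal k X ≤ LinearMap.ker (φ : _ →ₗ[k] Z) := by
    refine sInf_le ⟨fun x y z => ?_, fun x hx y => ?_, fun x y hy => ?_⟩
    · change φ ((x * y + y * x) * z - x * (y * z)) = 0
      simp only [map_sub, map_add, map_mul]
      exact sub_eq_zero.2 (hp (φ x) (φ y) (φ z))
    · exact (map_mul φ x y).trans ((congrArg (· * φ y) hx).trans (zero_mul (φ y)))
    · exact (map_mul φ x y).trans ((congrArg (φ x * ·) hy).trans (mul_zero (φ x)))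
  refine ⟨(zinbielIdeal k X).liftQ _ hφ, ?_,
    FreeNonUnitalNonAssocAlgebra.lift_of_apply k g⟩
  rintro ⟨x⟩ ⟨y⟩
  exact map_mul φ x y

end FreeZinbiel

section Polynomial

variable {k : Type*} [Field k]

/-- The antiderivative with zero constant term. -/
def polynomialAntiderivative : k[X] →ₗ[k] k[X] :=
  Polynomial.lsum fun n => (n + 1 : k)⁻¹ • monomial (n + 1)

theorem polynomialAntiderivative_monomial (n : ℕ) (c : k) :
    polynomialAntiderivative (monomial n c) = monomial (n + 1) ((n + 1 : k)⁻¹ * c) := by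
  simp [polynomialAntiderivative, Polynomial.sum_monomial_index, smul_monomial]

theorem eval_zero_polynomialAntiderivative (f : k[X]) :
    (polynomialAntiderivative f).eval 0 = 0 := by
  induction f using Polynomial.induction_on' with
  | add f g hf hg => rw [map_add, eval_add, hf, hg, add_zero]
  | monomial n a => simp [polynomialAntiderivative_monomial]

variable [CharZero k]

theorem derivative_polynomialAntiderivative (f : k[X]) :
    derivative (polynomialAntiderivative f) = f := by
  induction f using Polynomial.induction_on' with
  | add f g hf hg => rw [map_add, derivative_add, hf, hg]
  | monomial n a =>
    have hn : (n + 1 : k) ≠ 0 := n.cast_add_one_ne_zero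
    rw [polynomialAntiderivative_monomial, derivative_monomial, Nat.cast_add_one,
      Nat.add_sub_cancel, mul_right_comm, inv_mul_cancel₀ hn, one_mul]

theorem polynomialAntiderivative_derivative {f : k[X]} (hf : f.eval 0 = 0) :
    polynomialAntiderivative (derivative f) = f := by
  have hconst := eq_C_of_derivative_eq_zero
    (p := polynomialAntiderivative (derivative f) - f)
    (by rw [derivative_sub, derivative_polynomialAntiderivative, sub_self])
  rw [coeff_zero_eq_eval_zero, eval_sub, eval_zero_polynomialAntiderivative, hf, sub_zero,
    C_0] at hconst
  exact sub_eq_zero.1 hconst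

/-- The product `f ⋆ g = (∫ f) g` on polynomials. -/
def integralProduct : k[X] →ₗ[k] k[X] →ₗ[k] k[X] :=
  LinearMap.mul k k[X] ∘ₗ polynomialAntiderivative

theorem isIntegrationPair_integralProduct :
    IsIntegrationPair (integralProduct (k := k)) polynomialAntiderivative LinearMap.id where
  mul_integral f g := by
    let F : k[X] := polynomialAntiderivative f
    let G : k[X] := polynomialAntiderivative g
    have hFG : (F * G).eval 0 = 0 := by
      rw [eval_mul, eval_zero_polynomialAntiderivative, zero_mul]
    calc F * G = polynomialAntiderivative (derivative (F * G)) :=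
          (polynomialAntiderivative_derivative hFG).symm
      _ = polynomialAntiderivative (f * G + F * g) := by
          rw [derivative_mul, derivative_polynomialAntiderivative,
            derivative_polynomialAntiderivative]
      _ = polynomialAntiderivative (F * g + G * f) := by rw [add_comm, mul_comm f]
  integral_mul _ _ := rfl

theorem isZinbiel_integralProduct : IsZinbiel (integralProduct (k := k)) :=
  isIntegrationPair_integralProduct.isZinbiel Function.injective_id

end Polynomial

theorem FreeZinbiel.exists_isIntegrationPair_surjective {k : Type u} [Field k] [CharZero k]
    {X : Type w} [Nonempty X] :
    ∃ α β : FreeZinbiel k X →ₗ[k] k,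
      IsIntegrationPair (product k X) α β ∧ Function.Surjective (α.prod β) := by
  obtain ⟨θ, hθ, hθ_of⟩ := exists_lift (X := X) (isZinbiel_integralProduct (k := k)) fun _ => 1
  have h := (isIntegrationPair_integralProduct.map (aeval (1 : k))).comp hθ
  refine ⟨_, _, h, fun ⟨r, s⟩ => ?_⟩
  obtain ⟨i⟩ := ‹Nonempty X›
  let z : FreeZinbiel k X := of i
  have hz : θ z = monomial 0 1 := hθ_of i
  have hzz : θ (product k X z z) = monomial 1 1 := by
    rw [hθ, hz, integralProduct, LinearMap.comp_apply, polynomialAntiderivative_monomial,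
      LinearMap.mul_apply', monomial_mul_monomial]
    simp
  refine ⟨(2 * r - s) • z + (2 * (s - r)) • product k X z z, Prod.ext ?_ ?_⟩
  · simp [hz, hzz, polynomialAntiderivative_monomial, -monomial_zero_left]
    ring
  · simp [hz, hzz]
    ring

section BoxTimes

variable {k : Type u} [Field k] {Ω : Type v} {Z : Type t} [AddCommGroup Z] [Module k Z]
  {R : Type s} [CommRing R] [Algebra k R] {p : Z →ₗ[k] Z →ₗ[k] Z} {α β : Z →ₗ[k] R}
  (D : OmegaDialgebra.{u, v, w} k Ω) (hD : D.IsDiAlg₀)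

/-- The map `z ⊗ a ↦ α z ⊗ ā + β z ⊗ a` from `Z ⊠ D` to `R ⊗ D̂`. -/
def boxTimesToHat (α β : Z →ₗ[k] R) : Z ⊗[k] D.carrier →ₗ[k] R ⊗[k] (D.hat hD).carrier :=
  TensorProduct.map α (D.toHatBar hD) + TensorProduct.map β (D.toHatIdeal hD)

theorem isHom_boxTimesToHat (h : IsIntegrationPair p α β) :
    (boxTimes p D).IsHom ((D.hat hD).extendScalars R) (boxTimesToHat D hD α β) := fun ω =>
  LinearMap.congr_fun₂ (f := ((boxTimes p D).op ω).compr₂ (boxTimesToHat D hD α β))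
    (g := (((D.hat hD).extendScalars R).op ω).compl₁₂ (boxTimesToHat D hD α β)
      (boxTimesToHat D hD α β))
    (bilinear_ext_tmul fun z a w b => by
      change boxTimesToHat D hD α β (p z w ⊗ₜ D.left ω a b + p w z ⊗ₜ D.right ω a b) =
        TensorProduct.map₂ (LinearMap.mul k R) ((D.hat hD).op ω)
          (α z ⊗ₜ D.toHatBar hD a + β z ⊗ₜ D.toHatIdeal hD a)
          (α w ⊗ₜ D.toHatBar hD b + β w ⊗ₜ D.toHatIdeal hD b)
      simp only [boxTimesToHat, map_add, LinearMap.add_apply, TensorProduct.map_tmul,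
        TensorProduct.map₂_apply_tmul, LinearMap.mul_apply', D.hat_op_toHatBar_toHatBar,
        D.hat_op_toHatBar_toHatIdeal, D.hat_op_toHatIdeal_toHatBar,
        D.hat_op_toHatIdeal_toHatIdeal, D.toHatBar_right, TensorProduct.tmul_zero,
        h.mul_integral, h.integral_mul, mul_comm (β z), TensorProduct.add_tmul]
      abel)

theorem boxTimesToHat_injective {π : R →ₗ[k] Z} (hα : π ∘ₗ α = 0) (hβ : π ∘ₗ β = LinearMap.id) :
    Function.Injective (boxTimesToHat D hD α β) := by
  have hleft : TensorProduct.map π (D.hatSnd hD) ∘ₗ boxTimesToHat D hD α β = LinearMap.id := by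
    rw [boxTimesToHat, LinearMap.comp_add, ← TensorProduct.map_comp, ← TensorProduct.map_comp, hα,
      hβ, D.hatSnd_comp_toHatIdeal, TensorProduct.map_zero_left, zero_add, TensorProduct.map_id]
  exact Function.LeftInverse.injective (LinearMap.congr_fun hleft)

theorem boxTimesToHat_surjective (hs : Function.Surjective (α.prod β)) :
    Function.Surjective (boxTimesToHat D hD α β) := fun u => by
  induction u with
  | zero => exact ⟨0, map_zero _⟩
  | add u v hu hv =>
    obtain ⟨x, rfl⟩ := hu
    obtain ⟨y, rfl⟩ := hv
    exact ⟨x + y, map_add _ x y⟩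
  | tmul r c =>
    obtain ⟨a, b, rfl⟩ := D.exists_toHatBar_add_toHatIdeal hD c
    obtain ⟨z, hz⟩ := hs (r, 0)
    obtain ⟨w, hw⟩ := hs (0, r)
    obtain ⟨hαz, hβz⟩ : α z = r ∧ β z = 0 := Prod.ext_iff.1 hz
    obtain ⟨hαw, hβw⟩ : α w = 0 ∧ β w = r := Prod.ext_iff.1 hw
    exact ⟨z ⊗ₜ a + w ⊗ₜ b, by simp [boxTimesToHat, hαz, hβz, hαw, hβw, TensorProduct.tmul_add]⟩

theorem satisfies_boxTimes_of_satisfies_hat [Infinite k] (hp : IsZinbiel p)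
    {f : OmegaPolynomial k Ω} (hf : (D.hat hD).Satisfies f) : (boxTimes p D).Satisfies f := by
  obtain ⟨R, _, _, α, β, π, h, hα, hβ⟩ := hp.exists_isIntegrationPair
  exact (isHom_boxTimesToHat D hD h).satisfies_of_injective (boxTimesToHat_injective D hD hα hβ)
    (hf.extendScalars R)

theorem var_boxTimes_eq_var_hat [Infinite k] [Nontrivial R] (hp : IsZinbiel p)
    (h : IsIntegrationPair p α β) (hs : Function.Surjective (α.prod β)) :
    (boxTimes p D).Var = ((D.hat hD).Var : Set (OmegaAlgebra.{u, v, s'} k Ω)) :=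
  OmegaAlgebra.var_eq_of_satisfies_iff fun _ =>
    ⟨fun hf => OmegaAlgebra.Satisfies.of_extendScalars
      ((isHom_boxTimesToHat D hD h).satisfies_of_surjective
        (boxTimesToHat_surjective D hD hs) hf),
      satisfies_boxTimes_of_satisfies_hat D hD hp⟩

end BoxTimes

theorem theorem3_general {k : Type u} [Field k] [CharZero k] {Ω : Type v}
    (A : OmegaDialgebra.{u, v, w} k Ω) (hA : A.IsDiAlg₀) (X : Type s) [Nonempty X] :
    (boxTimes (FreeZinbiel.product k X) A).Var =
      ((A.hat hA).Var : Set (OmegaAlgebra.{u, v, t} k Ω)) := by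
  have : Infinite k := CharZero.infinite k
  obtain ⟨α, β, h, hs⟩ := FreeZinbiel.exists_isIntegrationPair_surjective (k := k) (X := X)
  exact var_boxTimes_eq_var_hat A hA FreeZinbiel.isZinbiel_product h hs

end

theorem theorem3 {k : Type u} [Field k] [CharZero k] {Ω : Type v}
    (A : OmegaDialgebra.{u, v, w} k Ω) (hA : A.IsDiAlg₀) (m : ℕ) (hm : 1 ≤ m) :
    (boxTimes (FreeZinbiel.product k (Fin m)) A).Var =
      ((A.hat hA).Var : Set (OmegaAlgebra.{u, v, t} k Ω)) := by
  have : Nonempty (Fin m) := ⟨⟨0, hm⟩⟩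
  exact theorem3_general A hA (Fin m)
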